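/- A matrix $T\in\mathbb{C}^{n\times n}$ is called Toeplitz if $T_{i,j}=T_{i+1,j+1}$ for all $i,j=1,\dots,n-1$. For $M\in\mathbb{C}^{n\times n}$, the Toeplitz number $\mathrm{Toep}(M)$ is the minimal $s\ge 1$ such that $M=T_1T_2\cdots T_s$ for some Toeplitz matrices $T_1,\dots,T_s\in\mathbb{C}^{n\times n}$ (and $\mathrm{Toep}(M)=\infty$ if no such $s$ exists). Proposition. Let $M\in\mathbb{C}^{4\times 4}$ be a matrix of rank $2$. Then $\mathrm{Toep}(M)\le 9$; that is, $M$ is a product of at most $9$ Toeplitz matrices of size $4\times 4$. -/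

import Mathlib

/-- A square complex matrix is Toeplitz if it is constant along its descending diagonals:
`M i j = M (i + 1) (j + 1)` whenever both positions lie in the matrix. -/
def IsToeplitz {n : ℕ} (M : Matrix (Fin n) (Fin n) ℂ) : Prop :=
  ∀ (i j : ℕ) (hi : i + 1 < n) (hj : j + 1 < n),
    M ⟨i, Nat.lt_of_succ_lt hi⟩ ⟨j, Nat.lt_of_succ_lt hj⟩ = M ⟨i + 1, hi⟩ ⟨j + 1, hj⟩

/-- `L = (T₁, …, T_s)`, with `s ≥ 1`, is a Toeplitz decomposition of `M`: every `T_i` is Toeplitz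
and `M = T₁ * ⋯ * T_s`. Its length is `s = L.length`. -/
def IsToeplitzDecomposition {n : ℕ} (L : List (Matrix (Fin n) (Fin n) ℂ))
    (M : Matrix (Fin n) (Fin n) ℂ) : Prop :=
  L ≠ [] ∧ (∀ T ∈ L, IsToeplitz T) ∧ L.prod = M

/-- The Toeplitz number of `M`: the minimal length of a Toeplitz decomposition of `M`
(with value `⊤` if there were no decomposition). -/
noncomputable def toeplitzNumber {n : ℕ} (M : Matrix (Fin n) (Fin n) ℂ) : ℕ∞ :=
  sInf {s : ℕ∞ | ∃ L : List (Matrix (Fin n) (Fin n) ℂ),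
    IsToeplitzDecomposition L M ∧ s = (L.length : ℕ∞)}

/-!
Read a vector of length `n` as a power series modulo `X ^ n`. Multiplication by a Laurent series
`X ^ (-k) * f` is then a Toeplitz matrix, whose entry `(i, j)` is the coefficient of
`X ^ (i + k)` in `X ^ j * f`.

If a power series `t` divides `s`, then `s = p * u` and `t = p * (1 + X * u)` for some `p` and `u`.
The series `u` and `1 + X * u` are consecutive columns of the Toeplitz matrix of
`X ^ (-k) * (1 + X * u)`, and multiplying by the Toeplitz matrix of `p` turns them into `s`
and `t`. So `s` and `t` can be placed in any two consecutive columns of a product of two Toeplitz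
matrices.

A matrix of rank at most two is `s s'ᵀ + t t'ᵀ`. As power series over a field form a valuation
ring, this expression can be changed so that `t ∣ s` and `t' ∣ s'`. Let `A` have first two columns
`s` and `t`, and let `B` have last two columns `s'` and `t'`. The matrix is then `A U Bᵀ`, where
the Toeplitz matrix `U` of `X ^ (-(n - 2))` selects these columns. This makes five factors.
-/

open Matrix PowerSeries

section Divisibility

theorem add_dvd_left_of_not_dvd {R : Type*} [CommRing R] [IsDomain R] [ValuationRing R]
    {s t : R} (h : ¬ t ∣ s) : s + t ∣ s := by
  obtain ⟨w, rfl⟩ := (ValuationRing.dvd_total s t).resolve_right h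
  have hw : ¬ IsUnit w := fun hw => h (hw.mul_right_dvd.mpr dvd_rfl)
  have hunit : IsUnit (1 + w) :=
    (IsLocalRing.isUnit_or_isUnit_of_add_one (add_neg_cancel_right 1 w)).resolve_right
      (by rwa [IsUnit.neg_iff])
  rw [← mul_one_add, hunit.mul_right_dvd]

theorem exists_dvd_bilinear_add_eq {k R S N : Type*} [CommSemiring k]
    [CommRing R] [IsDomain R] [ValuationRing R] [Module k R]
    [CommRing S] [IsDomain S] [ValuationRing S] [Module k S] [AddCommGroup N] [Module k N]
    (f : R →ₗ[k] S →ₗ[k] N) (s t : R) (s' t' : S) :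
    ∃ a b a' b', b ∣ a ∧ b' ∣ a' ∧ f a a' + f b b' = f s s' + f t t' := by
  by_cases h : t ∣ s <;> by_cases h' : t' ∣ s'
  · exact ⟨s, t, s', t', h, h', rfl⟩
  · refine ⟨s - t, t, s', s' + t', dvd_sub_self_right.mpr h, add_dvd_left_of_not_dvd h', ?_⟩
    simp only [map_sub, map_add, LinearMap.sub_apply]
    abel
  · refine ⟨s, s + t, s' - t', t', add_dvd_left_of_not_dvd h, dvd_sub_self_right.mpr h', ?_⟩
    simp only [map_sub, map_add, LinearMap.add_apply]
    abel
  · exact ⟨t, s, t', s', (ValuationRing.dvd_total s t).resolve_right h,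
      (ValuationRing.dvd_total s' t').resolve_right h', add_comm _ _⟩

theorem exists_eq_mul_and_eq_mul_one_add_X_mul {R : Type*} [CommRing R] {s t : R⟦X⟧}
    (h : t ∣ s) : ∃ p u, s = p * u ∧ t = p * (1 + X * u) := by
  obtain ⟨w, rfl⟩ := h
  have hunit : IsUnit (1 - X * w) := by simp [isUnit_iff_constantCoeff]
  obtain ⟨v, hv⟩ := hunit.exists_right_inv
  exact ⟨t * (1 - X * w), w * v, by linear_combination -(t * w) * hv,
    by linear_combination -(t * X * w) * hv⟩

end Divisibility

theorem exists_eq_sum_vecMulVec_of_rank_le {m n K : Type*} [Finite m] [Fintype n] [Field K]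
    {r : ℕ} {M : Matrix m n K} (hM : M.rank ≤ r) :
    ∃ (x : Fin r → m → K) (y : Fin r → n → K), M = ∑ i, vecMulVec (x i) (y i) := by
  classical
  obtain ⟨f, hf⟩ : ∃ f : LinearMap.range M.mulVecLin →ₗ[K] (Fin r → K), Function.Injective f :=
    finrank_le_iff_exists_linearMap.mp (by simpa [Matrix.rank] using hM)
  obtain ⟨g, hg⟩ := f.exists_leftInverse_of_injective (LinearMap.ker_eq_bot.mpr hf)
  let A := LinearMap.toMatrix' ((LinearMap.range M.mulVecLin).subtype ∘ₗ g)
  let B := LinearMap.toMatrix' (f ∘ₗ M.mulVecLin.rangeRestrict)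
  have hAB : M = A * B := by
    rw [← LinearMap.toMatrix'_comp, LinearMap.comp_assoc, ← LinearMap.comp_assoc _ f g, hg,
      LinearMap.id_comp, LinearMap.subtype_comp_codRestrict,
      ← toLin'_apply', LinearMap.toMatrix'_toLin']
  refine ⟨A.col, B.row, hAB.trans ?_⟩
  ext i j
  simp [mul_apply, Matrix.sum_apply, vecMulVec_apply]

section LaurentToeplitz

/-- The coefficient vector of a power series modulo `X ^ n`. -/
noncomputable def truncatedCoeffs (R : Type*) [Semiring R] (n : ℕ) : R⟦X⟧ →ₗ[R] (Fin n → R) :=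
  LinearMap.pi fun i => coeff (i : ℕ)

variable {R : Type*}

/-- The `n × n` Toeplitz matrix of the Laurent series `X ^ (-k) * f`: its entry `(i, j)` is the
coefficient of `X ^ i` in `X ^ j * (X ^ (-k) * f)`. The shift `k` is a parameter of its own, so that
only power series are needed. -/
noncomputable def laurentToeplitz [Semiring R] (n k : ℕ) (f : R⟦X⟧) : Matrix (Fin n) (Fin n) R :=
  Matrix.of fun i j => coeff ((i : ℕ) + k) (X ^ (j : ℕ) * f)

theorem truncatedCoeffs_surjective [Semiring R] (n : ℕ) :
    Function.Surjective (truncatedCoeffs R n) := fun x =>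
  ⟨PowerSeries.mk fun m => if h : m < n then x ⟨m, h⟩ else 0, by
    ext i
    simp [truncatedCoeffs]⟩

theorem laurentToeplitz_zero_mulVec_truncatedCoeffs [CommSemiring R] {n : ℕ} (p q : R⟦X⟧) :
    laurentToeplitz n 0 p *ᵥ truncatedCoeffs R n q = truncatedCoeffs R n (p * q) := by
  ext i
  let term : ℕ → R := fun j => coeff (i : ℕ) (X ^ j * p) * coeff j q
  have hterm : ∀ j ∈ Finset.range n, j ∉ Finset.range (i + 1) → term j = 0 := fun j _ hj => by
    simp only [term, coeff_X_pow_mul', if_neg (by simpa using hj : ¬ j ≤ i), zero_mul]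
  calc ∑ j : Fin n, term j = ∑ j ∈ Finset.range n, term j := Fin.sum_univ_eq_sum_range term n
    _ = ∑ j ∈ Finset.range (i + 1), term j :=
      (Finset.sum_subset (Finset.range_subset_range.mpr i.isLt) hterm).symm
    _ = ∑ j ∈ Finset.range (i + 1), coeff j q * coeff (i - j) p :=
      Finset.sum_congr rfl fun j hj => by
        dsimp only [term]
        rw [coeff_X_pow_mul', if_pos (Finset.mem_range_succ_iff.mp hj), mul_comm]
    _ = coeff (i : ℕ) (p * q) := by
      rw [mul_comm p q, coeff_mul, Finset.Nat.sum_antidiagonal_eq_sum_range_succ_mk]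

theorem laurentToeplitz_col_self [Semiring R] {n : ℕ} (j : Fin n) (f : R⟦X⟧) :
    (laurentToeplitz n j f).col j = truncatedCoeffs R n f := by
  ext i
  simp [laurentToeplitz, truncatedCoeffs, coeff_X_pow_mul]

theorem laurentToeplitz_succ_col_one_add_X_mul [Semiring R] {n : ℕ} (j : Fin n) (u : R⟦X⟧) :
    (laurentToeplitz n (j + 1) (1 + X * u)).col j = truncatedCoeffs R n u := by
  ext i
  simp [laurentToeplitz, truncatedCoeffs, ← add_assoc, add_right_comm _ (j : ℕ), coeff_X_pow_mul,
    coeff_one, coeff_succ_X_mul]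

theorem laurentToeplitz_one_eq_vecMulVec_add_vecMulVec [Semiring R] (m : ℕ) :
    laurentToeplitz (m + 2) m (1 : R⟦X⟧) =
      vecMulVec (Pi.single 0 1) (Pi.single (Fin.last m).castSucc 1) +
        vecMulVec (Pi.single 1 1) (Pi.single (Fin.last (m + 1)) 1) := by
  ext i j
  simp only [laurentToeplitz, of_apply, mul_one, coeff_X_pow, Matrix.add_apply, vecMulVec_apply,
    Pi.single_apply, Fin.ext_iff, Fin.val_castSucc, Fin.val_last, Fin.val_zero, Fin.val_one,
    mul_ite, mul_zero]
  grind

theorem mul_laurentToeplitz_one_mul_transpose [CommSemiring R] {m : ℕ} {p q : Type*}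
    (A : Matrix p (Fin (m + 2)) R) (B : Matrix q (Fin (m + 2)) R) :
    A * laurentToeplitz (m + 2) m (1 : R⟦X⟧) * Bᵀ =
      vecMulVec (A.col 0) (B.col (Fin.last m).castSucc) +
        vecMulVec (A.col 1) (B.col (Fin.last (m + 1))) := by
  simp only [laurentToeplitz_one_eq_vecMulVec_add_vecMulVec, Matrix.mul_add, Matrix.add_mul,
    mul_vecMulVec, vecMulVec_mul, vecMul_transpose, mulVec_single_one]

theorem exists_dvd_eq_vecMulVec_add_vecMulVec {K : Type*} [Field K] {m n : ℕ}
    {M : Matrix (Fin m) (Fin n) K} (hM : M.rank ≤ 2) :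
    ∃ s t s' t' : K⟦X⟧, t ∣ s ∧ t' ∣ s' ∧
      M = vecMulVec (truncatedCoeffs K m s) (truncatedCoeffs K n s') +
        vecMulVec (truncatedCoeffs K m t) (truncatedCoeffs K n t') := by
  obtain ⟨x, y, rfl⟩ := exists_eq_sum_vecMulVec_of_rank_le hM
  choose left hleft using truncatedCoeffs_surjective (R := K) m
  choose right hright using truncatedCoeffs_surjective (R := K) n
  obtain ⟨s, t, s', t', hts, hts', heq⟩ := exists_dvd_bilinear_add_eq
    ((vecMulVecBilin K K).compl₁₂ (truncatedCoeffs K m) (truncatedCoeffs K n))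
    (left (x 0)) (left (x 1)) (right (y 0)) (right (y 1))
  refine ⟨s, t, s', t', hts, hts', ?_⟩
  simpa only [LinearMap.compl₁₂_apply, vecMulVecBilin_apply_apply, hleft, hright,
    ← Fin.sum_univ_two fun i => vecMulVec (x i) (y i)] using heq.symm

end LaurentToeplitz

section Toeplitz

variable {n : ℕ}

theorem isToeplitz_laurentToeplitz (k : ℕ) (f : ℂ⟦X⟧) : IsToeplitz (laurentToeplitz n k f) :=
  fun i j _ _ => by
    simp only [laurentToeplitz, of_apply, pow_succ', mul_assoc, add_right_comm i 1 k,
      coeff_succ_X_mul]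

theorem IsToeplitz.transpose {T : Matrix (Fin n) (Fin n) ℂ} (hT : IsToeplitz T) :
    IsToeplitz Tᵀ :=
  fun i j hi hj => hT j i hj hi

theorem isToeplitz_of_lt_two (hn : n < 2) (M : Matrix (Fin n) (Fin n) ℂ) : IsToeplitz M :=
  fun _ _ _ _ => by omega

theorem IsToeplitzDecomposition.toeplitzNumber_le {L : List (Matrix (Fin n) (Fin n) ℂ)}
    {M : Matrix (Fin n) (Fin n) ℂ} (h : IsToeplitzDecomposition L M) :
    toeplitzNumber M ≤ L.length :=
  sInf_le ⟨L, h, rfl⟩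

theorem exists_isToeplitz_mul_col_eq_of_dvd {s t : ℂ⟦X⟧} (h : t ∣ s) {i j : Fin n}
    (hij : (i : ℕ) + 1 = j) :
    ∃ L T : Matrix (Fin n) (Fin n) ℂ, IsToeplitz L ∧ IsToeplitz T ∧
      (L * T).col i = truncatedCoeffs ℂ n s ∧ (L * T).col j = truncatedCoeffs ℂ n t := by
  obtain ⟨p, u, rfl, rfl⟩ := exists_eq_mul_and_eq_mul_one_add_X_mul h
  refine ⟨laurentToeplitz n 0 p, laurentToeplitz n j (1 + X * u),
    isToeplitz_laurentToeplitz _ _, isToeplitz_laurentToeplitz _ _, ?_, ?_⟩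
  · rw [← mulVec_single_one, ← mulVec_mulVec, mulVec_single_one, ← hij,
      laurentToeplitz_succ_col_one_add_X_mul, laurentToeplitz_zero_mulVec_truncatedCoeffs]
  · rw [← mulVec_single_one, ← mulVec_mulVec, mulVec_single_one,
      laurentToeplitz_col_self, laurentToeplitz_zero_mulVec_truncatedCoeffs]

end Toeplitz

theorem mainTheorem7_general {n : ℕ} (M : Matrix (Fin n) (Fin n) ℂ) (hM : M.rank ≤ 2) :
    toeplitzNumber M ≤ 5 := by
  obtain hn | hn := lt_or_ge n 2
  · have hdec : IsToeplitzDecomposition [M] M := by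
      simp [IsToeplitzDecomposition, isToeplitz_of_lt_two hn M]
    exact hdec.toeplitzNumber_le.trans (by norm_num)
  obtain ⟨m, rfl⟩ := Nat.exists_eq_add_of_le' hn
  obtain ⟨s, t, s', t', hts, hts', rfl⟩ := exists_dvd_eq_vecMulVec_add_vecMulVec hM
  obtain ⟨L, T, hL, hT, hs, ht⟩ :=
    exists_isToeplitz_mul_col_eq_of_dvd hts (i := (0 : Fin (m + 2))) (j := 1) rfl
  obtain ⟨L', T', hL', hT', hs', ht'⟩ :=
    exists_isToeplitz_mul_col_eq_of_dvd hts' (i := (Fin.last m).castSucc) (j := Fin.last (m + 1))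
      rfl
  let U : Matrix (Fin (m + 2)) (Fin (m + 2)) ℂ := laurentToeplitz (m + 2) m 1
  have hU : IsToeplitz U := isToeplitz_laurentToeplitz m 1
  rw [← hs, ← ht, ← hs', ← ht', ← mul_laurentToeplitz_one_mul_transpose]
  have hdec : IsToeplitzDecomposition [L, T, U, T'ᵀ, L'ᵀ] (L * T * U * (L' * T')ᵀ) :=
    ⟨by simp, by simp [hL, hT, hU, hT'.transpose, hL'.transpose],
      by simp [transpose_mul, Matrix.mul_assoc]⟩
  exact hdec.toeplitzNumber_le

theorem mainTheorem7 (M : Matrix (Fin 4) (Fin 4) ℂ) (hM : M.rank = 2) :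
    toeplitzNumber M ≤ 9 :=
  (mainTheorem7_general M hM.le).trans (by norm_num)
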